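/- A variety is a reduced separated scheme of finite type over $\mathbb{C}$ (possibly reducible or empty), $K_0(\mathcal V_{\mathbb C})$ is the Grothendieck ring of varieties, $F(X)$ is the group of constructible functions $X\to\mathbb Z$ (finitely many values, constructible level sets), and $\Gamma:F(X)\to K_0(\mathcal V_{\mathbb C})$ is $\Gamma(\alpha)=\sum_{n\in\mathbb Z} n\,[\alpha^{-1}(n)]$, where the class of a constructible set is the sum of the classes of the parts of any finite partition into locally closed subvarieties. For a projective system $\cdots\to X_3\to X_2\to X_1$ of varieties with structure morphisms $\pi_{nm}:X_m\to X_n$ and limit $X_\infty$, put $F^{\mathrm{pro}}(X_\infty)=\varinjlim_n F(X_n)$ along the pull-backs $\pi_{nm}^*$, and write $[\alpha_n]$ for the class of $\alpha_n\in F(X_n)$. Say that $\pi:X\to Y$ is multiplicative on classes with fibre $F$ if $[\pi^{-1}(Z)]=[Z]\,[F]$ in $K_0(\mathcal V_{\mathbb C})$ for every closed subvariety $Z\subseteq Y$ (in particular $[X]=[Y][F]$). Theorem. (0) If $\pi:X\to Y$ is a Zariski locally trivial fibre bundle with fibre a variety $F$, then $[X]=[Y][F]$, and $\pi$ is multiplicative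 on classes with fibre $F$. (i) Let $F_0$ be a point and let $F_1,F_2,\dots$ be varieties such that for every $n\ge 1$ the morphism $\pi_{n(n+1)}:X_{n+1}\to X_n$ is multiplicative on classes with fibre $F_n$ (for example, a Zariski locally trivial fibre bundle with fibre $F_n$). Let $\mathcal F$ be the multiplicative set generated by the $[F_j]$ and $K_0(\mathcal V_{\mathbb C})_{\mathcal F}$ the localization. Then the canonical Grothendieck proclass homomorphism $\Gamma^{\mathrm{pro}}:F^{\mathrm{pro}}(X_\infty)\to K_0(\mathcal V_{\mathbb C})_{\mathcal F}$ exists and is unique. Here $\Gamma^{\mathrm{pro}}$ is the composite of the homomorphism $F^{\mathrm{pro}}(X_\infty)\to\varinjlim_n\{\times[F_n]:K_0(\mathcal V_{\mathbb C})\to K_0(\mathcal V_{\mathbb C})\}$ that is $\Gamma$ at every level, and the homomorphism from this inductive limit to $K_0(\mathcal V_{\mathbb C})_{\mathcal F}$ that is division by $[F_0][F_1]\cdots[F_{n-1}]$ on the $n$-th copy. For all finite sums it is given by $$\Gamma^{\mathrm{pro}}\Bigl(\sum_n[\alpha_n]\Bigr)=\sum_n\frac{\Gamma(\alpha_n)}{[F_0][F_1]\cdots[F_{n-1}]}.$$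 (ii) If moreover $F_n=W$ for all $n\ge1$, then $\mathcal F=\{[W]^k : k\ge 0\}$ and $$\Gamma^{\mathrm{pro}}\Bigl(\sum_n[\alpha_n]\Bigr)=\sum_n\frac{\Gamma(\alpha_n)}{[W]^{n-1}};$$ and for every integer $w$ there is a unique homomorphism $\Gamma^{\mathrm{pro}}_w:F^{\mathrm{pro}}(X_\infty)\to K_0(\mathcal V_{\mathbb C})_{[W]}$, where $K_0(\mathcal V_{\mathbb C})_{[W]}=K_0(\mathcal V_{\mathbb C})_{\mathcal F}$, with $$\Gamma^{\mathrm{pro}}_w\Bigl(\sum_n[\alpha_n]\Bigr)=\sum_n\frac{\Gamma(\alpha_n)}{[W]^{n-1+w}}.$$ -/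

import Mathlib

open CategoryTheory CategoryTheory.Limits AlgebraicGeometry TensorProduct MonoidalCategory Opposite

namespace ProMotivic

noncomputable section


theorem isReduced_tensorProduct_of_isAlgClosed (k A B : Type) [Field k] [IsAlgClosed k]
    [CommRing A] [CommRing B] [Algebra k A] [Algebra k B] [Algebra.FiniteType k A]
    [_root_.IsReduced A] [_root_.IsReduced B] : _root_.IsReduced (A ⊗[k] B) := by
  have hJ : IsJacobsonRing A := isJacobsonRing_of_finiteType (A := k)
  have hsep : ∀ a : A, (∀ φ : A →ₐ[k] k, φ a = 0) → a = 0 := by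
    intro a ha
    have h1 : a ∈ (⊥ : Ideal A).jacobson := by
      rw [Ideal.mem_jacobson_bot, ← Ideal.mem_jacobson_bot, Ideal.jacobson, Ideal.mem_sInf]
      rintro M ⟨-, hM⟩
      let _ : Field (A ⧸ M) := Ideal.Quotient.field M
      have : Module.Finite k (A ⧸ M) := finite_of_finite_type_of_isJacobsonRing k (A ⧸ M)
      let e : k ≃ₐ[k] (A ⧸ M) := AlgEquiv.ofBijective (Algebra.ofId k (A ⧸ M))
        (IsAlgClosed.algebraMap_bijective_of_isIntegral (k := k) (K := A ⧸ M))
      have h2 := ha (e.symm.toAlgHom.comp (Ideal.Quotient.mkₐ k M))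
      have h3 : e.symm (Ideal.Quotient.mk M a) = 0 := h2
      rw [map_eq_zero_iff _ e.symm.injective] at h3
      exact Ideal.Quotient.eq_zero_iff_mem.mp h3
    rw [← Ideal.radical_eq_jacobson] at h1
    obtain ⟨n, hn⟩ := h1
    exact eq_zero_of_pow_eq_zero (n := n) (by simpa using hn)
  let c := Module.Basis.ofVectorSpace k B
  refine ⟨fun x hx => ?_⟩
  apply (Algebra.TensorProduct.basis A c).repr.injective
  ext i
  rw [map_zero, Finsupp.zero_apply]
  apply hsep
  intro φ
  have h0 : (Algebra.TensorProduct.lift ((Algebra.ofId k B).comp φ) (AlgHom.id k B)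
      fun _ _ => .all _ _) x = 0 := (hx.map _).eq_zero
  have key : ∀ x : A ⊗[k] B, c.repr ((Algebra.TensorProduct.lift ((Algebra.ofId k B).comp φ)
      (AlgHom.id k B) fun _ _ => .all _ _) x) i =
      φ ((Algebra.TensorProduct.basis A c).repr x i) := by
    intro x
    induction x with
    | zero => simp
    | add x y hx hy => simp [hx, hy]
    | tmul a b => 
      rw [Algebra.TensorProduct.lift_tmul, AlgHom.comp_apply, Algebra.ofId_apply, AlgHom.id_apply,
        ← Algebra.smul_def]
      simp [Algebra.TensorProduct.basis_repr_tmul]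
  rw [← key, h0]; simp

theorem isReduced_pullback_of_isAlgClosed_affine {k : Type} [Field k] [IsAlgClosed k]
    (X Y : Scheme.{0}) [IsAffine X] [IsAffine Y]
    (f : X ⟶ Spec (.of k)) (g : Y ⟶ Spec (.of k)) [LocallyOfFiniteType f]
    [AlgebraicGeometry.IsReduced X] [AlgebraicGeometry.IsReduced Y] :
    AlgebraicGeometry.IsReduced (pullback f g) := by
  obtain ⟨φ, hφ⟩ := Spec.map_surjective (X.isoSpec.inv ≫ f)
  obtain ⟨ψ, hψ⟩ := Spec.map_surjective (Y.isoSpec.inv ≫ g)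
  have hft : LocallyOfFiniteType (Spec.map φ) := hφ ▸ inferInstance
  rw [HasRingHomProperty.Spec_iff (P := @LocallyOfFiniteType)] at hft
  algebraize [φ.hom, ψ.hom]
  have := isReduced_tensorProduct_of_isAlgClosed k Γ(X, ⊤) Γ(Y, ⊤)
  have hr : AlgebraicGeometry.IsReduced (pullback (Spec.map φ) (Spec.map ψ)) :=
    isReduced_of_isOpenImmersion (pullbackSpecIso k Γ(X, ⊤) Γ(Y, ⊤)).hom
  exact isReduced_of_isOpenImmersion (pullback.map f g (Spec.map φ) (Spec.map ψ)
    X.isoSpec.hom Y.isoSpec.hom (𝟙 _) (by simp [hφ]) (by simp [hψ]))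

theorem isReduced_pullback_of_isAlgClosed {k : Type} [Field k] [IsAlgClosed k] {X Y : Scheme.{0}}
    (f : X ⟶ Spec (.of k)) (g : Y ⟶ Spec (.of k)) [LocallyOfFiniteType f]
    [AlgebraicGeometry.IsReduced X] [AlgebraicGeometry.IsReduced Y] :
    AlgebraicGeometry.IsReduced (pullback f g) := by
  apply +allowSynthFailures @AlgebraicGeometry.IsReduced.of_openCover
    (𝒰 := Scheme.Pullback.openCoverOfLeftRight X.affineCover Y.affineCover f g)
  rintro ⟨i, j⟩
  have h1 : IsOpenImmersion (X.affineCover.f i) := X.affineCover.map_prop i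
  have h2 : IsOpenImmersion (Y.affineCover.f j) := Y.affineCover.map_prop j
  have h3 := isReduced_of_isOpenImmersion (X.affineCover.f i)
  have h4 := isReduced_of_isOpenImmersion (Y.affineCover.f j)
  exact isReduced_pullback_of_isAlgClosed_affine (X.affineCover.X i) (Y.affineCover.X j)
    (X.affineCover.f i ≫ f) (Y.affineCover.f j ≫ g)

/-- A complex algebraic variety: a reduced separated scheme of finite type over `Spec ℂ`
(possibly reducible, possibly empty). -/
def IsVariety : ObjectProperty (Over (Spec (.of ℂ))) := fun V =>
  AlgebraicGeometry.IsReduced V.left ∧ LocallyOfFiniteType V.hom ∧ QuasiCompact V.hom ∧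
    IsSeparated V.hom

/-- The category `𝒱_ℂ` of complex algebraic varieties; morphisms are the morphisms over `ℂ`. -/
abbrev Variety : Type 1 := IsVariety.FullSubcategory

theorem isVariety_unit : IsVariety (𝟙_ (Over (Spec (.of ℂ)))) := by
  refine ⟨?_, ?_, ?_, ?_⟩
  · show AlgebraicGeometry.IsReduced (Spec (.of ℂ))
    infer_instance
  · exact inferInstanceAs (LocallyOfFiniteType (𝟙 (Spec (.of ℂ))))
  · exact inferInstanceAs (QuasiCompact (𝟙 (Spec (.of ℂ))))
  · exact inferInstanceAs (IsSeparated (𝟙 (Spec (.of ℂ))))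

theorem isVariety_tensor (V W : Over (Spec (.of ℂ))) (hV : IsVariety V) (hW : IsVariety W) :
    IsVariety (V ⊗ W) := by
  obtain ⟨h1, h2, h3, h4⟩ := hV
  obtain ⟨k1, k2, k3, k4⟩ := hW
  refine ⟨?_, ?_, ?_, ?_⟩
  · exact isReduced_pullback_of_isAlgClosed V.hom W.hom
  all_goals
    rw [Over.tensorObj_hom]
    infer_instance

theorem isVariety_of_iso {V W : Over (Spec (.of ℂ))} (e : V ≅ W) (hV : IsVariety V) :
    IsVariety W := by
  obtain ⟨h1, h2, h3, h4⟩ := hV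
  have he : e.inv.left ≫ V.hom = W.hom := Over.w e.inv
  have : IsIso e.inv.left := inferInstanceAs (IsIso ((Over.forget _).map e.inv))
  refine ⟨isReduced_of_isOpenImmersion e.inv.left, ?_, ?_, ?_⟩
  all_goals
    rw [← he]
    infer_instance

instance : IsVariety.IsClosedUnderLimitsOfShape (Discrete PEmpty) where
  limitsOfShape_le V := by
    rintro ⟨h⟩
    exact isVariety_of_iso (CartesianMonoidalCategory.isTerminalTensorUnit.uniqueUpToIso
      (isLimitEquivIsTerminalOfIsEmpty _ _ h.isLimit)) isVariety_unit

instance : IsVariety.IsClosedUnderLimitsOfShape (Discrete WalkingPair) where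
  limitsOfShape_le V := by
    rintro ⟨h⟩
    let i := (IsLimit.postcomposeHomEquiv (diagramIsoPair h.diag) _).symm h.isLimit
    exact isVariety_of_iso ((CartesianMonoidalCategory.tensorProductIsBinaryProduct
      (h.diag.obj ⟨.left⟩) (h.diag.obj ⟨.right⟩)).conePointUniqueUpToIso i)
      (isVariety_tensor _ _ (h.prop_diag_obj _) (h.prop_diag_obj _))

instance : BraidedCategory Variety := .ofCartesianMonoidalCategory


/-- The underlying set of points of a variety, with the Zariski topology. -/
abbrev Variety.Pt (V : Variety) : Type := V.obj.left

/-- The morphism of schemes underlying a morphism of varieties. -/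
abbrev Variety.schemeHom {V W : Variety} (f : V ⟶ W) : V.obj.left ⟶ W.obj.left := f.hom.left

/-- The one-point variety `Spec ℂ`. -/
abbrev Variety.point : Variety := 𝟙_ Variety

/-- The free abelian group on the set of isomorphism classes of varieties. It is a commutative ring
for `[V] * [W] = [V × W]`, as the isomorphism classes form a commutative monoid under products. -/
abbrev FreeVar : Type 1 := FreeAbelianGroup (Skeleton Variety)

/-- The isomorphism class of `V` as a generator of the free group. -/
def freeClass (V : Variety) : FreeVar := FreeAbelianGroup.of (toSkeleton V)

/-- The elements `[V] - [V'] - [V \ V']`, where `V' ⊆ V` is a closed subvariety (embedded by `i`)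
and `V \ V'` is the complementary open subvariety (embedded by `j`). -/
def scissorRelations : Set FreeVar :=
  {x | ∃ (V V' U : Variety) (i : V' ⟶ V) (j : U ⟶ V),
    IsClosedImmersion (Variety.schemeHom i) ∧ IsOpenImmersion (Variety.schemeHom j) ∧
    Set.range (Variety.schemeHom j) = (Set.range (Variety.schemeHom i))ᶜ ∧
    x = freeClass V - freeClass V' - freeClass U}

/-- The Grothendieck ring `K₀(𝒱_ℂ)` of complex algebraic varieties. (The subgroup generated by the
scissor relations is stable under multiplication by each `[W]`, so it is the ideal they span.) -/
abbrev K0Var : Type 1 := FreeVar ⧸ Ideal.span scissorRelations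

/-- The Grothendieck class `[V] ∈ K₀(𝒱_ℂ)` of a variety. -/
def varClass (V : Variety) : K0Var := Ideal.Quotient.mk _ (freeClass V)

instance (V : Variety) : TopologicalSpace.NoetherianSpace V.Pt := by
  obtain ⟨-, h2, h3, -⟩ := V.property
  have : IsLocallyNoetherian V.obj.left := LocallyOfFiniteType.isLocallyNoetherian V.obj.hom
  have : CompactSpace V.obj.left := QuasiCompact.compactSpace_of_compactSpace V.obj.hom
  have : IsNoetherian V.obj.left := {}
  infer_instance

/-- Constructible functions on a variety `X`: integer-valued functions that take finitely many
values, each of them on a constructible set. They form the abelian group `F(X)`. -/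
def ConstrFun (X : Variety) : AddSubgroup (X.Pt → ℤ) where
  carrier := {α | (Set.range α).Finite ∧ ∀ n : ℤ, Topology.IsConstructible (α ⁻¹' {n})}
  zero_mem' := by
    refine ⟨Set.finite_range_const.subset (Set.range_subset_iff.2 fun x => ⟨x, rfl⟩), fun n => ?_⟩
    by_cases h : n = 0
    · convert Topology.IsConstructible.univ
      ext x; simp [h]
    · convert Topology.IsConstructible.empty
      ext x; simp [Ne.symm h]
  add_mem' := by
    rintro α β ⟨hα, hα'⟩ ⟨hβ, hβ'⟩
    refine ⟨(hα.add hβ).subset ?_, fun n => ?_⟩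
    · rintro _ ⟨x, rfl⟩
      exact Set.add_mem_add ⟨x, rfl⟩ ⟨x, rfl⟩
    · have : (α + β) ⁻¹' {n} = ⋃ a ∈ Set.range α, (α ⁻¹' {a} ∩ β ⁻¹' {n - a}) := by
        ext x
        simp only [Set.mem_preimage, Pi.add_apply, Set.mem_singleton_iff, Set.mem_iUnion,
          Set.mem_inter_iff, exists_prop, Set.mem_range, exists_exists_eq_and]
        exact ⟨fun h => ⟨x, rfl, by omega⟩, fun ⟨y, h1, h2⟩ => by omega⟩
      rw [this]
      exact Topology.IsConstructible.biUnion hα fun a _ => (hα' a).inter (hβ' _)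
  neg_mem' := by
    rintro α ⟨hα, hα'⟩
    refine ⟨?_, fun n => ?_⟩
    · rw [show Set.range (-α) = -Set.range α by ext; simp [neg_eq_iff_eq_neg]]
      exact hα.neg
    · convert hα' (-n) using 1
      ext x; simp [neg_eq_iff_eq_neg]

/-- The pull-back `f^* : F(Y) → F(X)`, `α ↦ α ∘ f`, of constructible functions. -/
def ConstrFun.pullback {X Y : Variety} (f : X ⟶ Y) : ConstrFun Y →+ ConstrFun X where
  toFun α := ⟨fun x => α.1 (Variety.schemeHom f x), α.2.1.subset (Set.range_comp_subset_range _ _),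
    fun n => (α.2.2 n).preimage (f := Variety.schemeHom f) (Variety.schemeHom f).continuous fun _ _ _ _ _ _ =>
      TopologicalSpace.NoetherianSpace.isCompact _⟩
  map_zero' := rfl
  map_add' _ _ := rfl

/-- `c` is the sum `∑ [V_j]` for some partition of `C ⊆ X` into finitely many locally closed
subvarieties `V_j` of `X`. -/
def IsPartitionClass {X : Variety} (C : Set X.Pt) (c : K0Var) : Prop :=
  ∃ (k : ℕ) (V : Fin k → Variety) (i : ∀ j, V j ⟶ X),
    (∀ j, IsImmersion (Variety.schemeHom (i j))) ∧
    Pairwise (fun j l => Disjoint (Set.range (Variety.schemeHom (i j)))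
      (Set.range (Variety.schemeHom (i l)))) ∧
    (⋃ j, Set.range (Variety.schemeHom (i j))) = C ∧
    c = ∑ j, varClass (V j)

open Classical in
/-- The class `[C] ∈ K₀(𝒱_ℂ)` of a constructible subset `C` of a variety: the sum of the classes of
the parts in a partition of `C` into finitely many locally closed subvarieties. By the scissor
relations it does not depend on the partition. (Other sets get the value `0`.) -/
def constrClass {X : Variety} (C : Set X.Pt) : K0Var :=
  if h : ∃ c, IsPartitionClass C c then h.choose else 0

/-- The Grothendieck class `Γ(α) = ∑ₙ n [α⁻¹(n)]` of a constructible function, the sum being over the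
finitely many values of `α`. -/
def grothendieckClass {X : Variety} (α : ConstrFun X) : K0Var :=
  ∑ n ∈ α.2.1.toFinset, n • constrClass (α.1 ⁻¹' {n})

/-- `π : X ⟶ Y` is a Zariski locally trivial fibre bundle with fibre `F`: every point of `Y` has a
Zariski open neighbourhood `U` with `π⁻¹(U) ≅ U × F` over `U`. -/
def IsZariskiBundle {X Y : Variety} (π : X ⟶ Y) (F : Variety) : Prop :=
  ∀ y : Y.Pt, ∃ U : Y.obj.left.Opens, y ∈ U ∧
    ∃ e : ((Variety.schemeHom π) ⁻¹ᵁ U).toScheme ≅ Limits.pullback (U.ι ≫ Y.obj.hom) F.obj.hom,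
      e.hom ≫ Limits.pullback.fst _ _ = Variety.schemeHom π ∣_ U

/-- `π : X ⟶ Y` is multiplicative on classes with fibre `F`: for every closed subvariety `Z` of `Y`
(embedded by `i`), `[π⁻¹(Z)] = [Z] [F]`, where `π⁻¹(Z)` is the closed subvariety of `X` (embedded by
`j`) with that underlying set. For `Z = Y` this says `[X] = [Y] [F]`. -/
def IsClassMultiplicative {X Y : Variety} (π : X ⟶ Y) (F : Variety) : Prop :=
  ∀ (Z P : Variety) (i : Z ⟶ Y) (j : P ⟶ X), IsClosedImmersion (Variety.schemeHom i) →
    IsClosedImmersion (Variety.schemeHom j) →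
    Set.range (Variety.schemeHom j) = Variety.schemeHom π ⁻¹' Set.range (Variety.schemeHom i) →
    varClass P = varClass Z * varClass F

/-- A projective system `⋯ → X₃ → X₂ → X₁` of varieties, indexed by the positive integers; the
proalgebraic variety `X_∞` is its projective limit. -/
abbrev Tower : Type 1 := ℕ+ᵒᵖ ⥤ Variety

/-- The term `X_n`. -/
abbrev Tower.term (X : Tower) (n : ℕ+) : Variety := X.obj (op n)

/-- The structure morphism `π_{nm} : X_m ⟶ X_n` for `n ≤ m`. -/
abbrev Tower.str (X : Tower) {n m : ℕ+} (h : n ≤ m) : X.term m ⟶ X.term n := X.map (homOfLE h).op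

/-- The structure morphism `π_{n(n+1)} : X_{n+1} ⟶ X_n`. -/
abbrev Tower.step (X : Tower) (n : ℕ+) : X.term (n + 1) ⟶ X.term n :=
  X.str (PNat.lt_add_right n 1).le

/-- The group `F^pro(X_∞) = colim_n F(X_n)` of proconstructible functions, the inductive limit along
the pull-backs `π_{nm}^*`. -/
abbrev ProConstr (X : Tower) : Type :=
  AddCommGroup.DirectLimit (fun n : ℕ+ => ConstrFun (X.term n))
    (fun _ _ h => ConstrFun.pullback (X.str h))

/-- The class `[α_n] ∈ F^pro(X_∞)` of `α_n ∈ F(X_n)`. -/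
def proClass (X : Tower) (n : ℕ+) : ConstrFun (X.term n) →+ ProConstr X :=
  AddCommGroup.DirectLimit.of (fun n : ℕ+ => ConstrFun (X.term n))
    (fun _ _ h => ConstrFun.pullback (X.str h)) n

/-- The multiplicative set `𝓕` generated by the classes `[F_j]`. -/
def fibreMonoid (F : ℕ → Variety) : Submonoid K0Var :=
  Submonoid.closure (Set.range fun j => varClass (F j))

theorem varClass_mem_fibreMonoid (F : ℕ → Variety) (j : ℕ) : varClass (F j) ∈ fibreMonoid F :=
  Submonoid.subset_closure ⟨j, rfl⟩

/-- The localization `K₀(𝒱_ℂ)_𝓕`. -/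
abbrev K0Loc (F : ℕ → Variety) : Type 1 := Localization (fibreMonoid F)

/-- The denominator `[F₀] [F₁] ⋯ [F_{n-1}]`, as an element of `𝓕`. -/
def fibreDenom (F : ℕ → Variety) (n : ℕ) : fibreMonoid F :=
  ⟨∏ j ∈ Finset.range n, varClass (F j), prod_mem fun j _ => varClass_mem_fibreMonoid F j⟩

/-- The inductive limit of `K₀(𝒱_ℂ) → K₀(𝒱_ℂ) → ⋯` (a copy for every `n ≥ 1`), the transition map
from the `n`-th to the `m`-th copy being multiplication by `[F_n] ⋯ [F_{m-1}]`. -/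
abbrev K0Colim (F : ℕ → Variety) : Type 1 :=
  AddCommGroup.DirectLimit (fun _ : ℕ+ => K0Var)
    (fun n m _ => AddMonoidHom.mulLeft (∏ j ∈ Finset.Ico (n : ℕ) m, varClass (F j)))

/-- The canonical homomorphism `K₀(𝒱_ℂ) → colim` from the `n`-th copy. -/
def K0Colim.of (F : ℕ → Variety) (n : ℕ+) : K0Var →+ K0Colim F :=
  AddCommGroup.DirectLimit.of (fun _ : ℕ+ => K0Var)
    (fun n m _ => AddMonoidHom.mulLeft (∏ j ∈ Finset.Ico (n : ℕ) m, varClass (F j))) n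

/-- `G` is the canonical Grothendieck proclass homomorphism `Γ^pro`: the composite of the
homomorphism `γ : F^pro(X_∞) → colim K₀(𝒱_ℂ)` which is `Γ` at every level `n`, and the canonical
homomorphism `φ : colim K₀(𝒱_ℂ) → K₀(𝒱_ℂ)_𝓕` which is division by `[F₀] ⋯ [F_{n-1}]` on the `n`-th
copy. -/
def IsCanonicalProclass (X : Tower) (F : ℕ → Variety) (G : ProConstr X →+ K0Loc F) : Prop :=
  ∃ (γ : ProConstr X →+ K0Colim F) (φ : K0Colim F →+ K0Loc F),
    (∀ (n : ℕ+) (α : ConstrFun (X.term n)),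
      γ (proClass X n α) = K0Colim.of F n (grothendieckClass α)) ∧
    (∀ (n : ℕ+) (c : K0Var), φ (K0Colim.of F n c) = Localization.mk c (fibreDenom F n)) ∧
    G = φ.comp γ

/-- The fibre sequence with `F₀` a point and `F_n = W` for all `n ≥ 1`. -/
def constFibre (W : Variety) : ℕ → Variety
  | 0 => Variety.point
  | _ + 1 => W

/-- The power `[W]^k` as an element of the multiplicative set of the constant fibre sequence. -/
def constDenom (W : Variety) (k : ℕ) : fibreMonoid (constFibre W) :=
  ⟨varClass W ^ k, pow_mem (varClass_mem_fibreMonoid (constFibre W) 1) k⟩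

/-- The class `[W]` as a unit of the localization `K₀(𝒱_ℂ)_{[W]}`. -/
def constUnit (W : Variety) : (K0Loc (constFibre W))ˣ :=
  (IsLocalization.map_units (K0Loc (constFibre W)) (⟨varClass W, varClass_mem_fibreMonoid
    (constFibre W) 1⟩ : fibreMonoid (constFibre W))).unit

end

end ProMotivic

open ProMotivic

namespace ProMotivic

open TopologicalSpace

noncomputable section

theorem linearCombination_valuation_eq_zero {X A : Type*} [TopologicalSpace X] [NoetherianSpace X]
    [AddCommGroup A] (m : Closeds X → A) (hbot : m ⊥ = 0)
    (hm : ∀ Z W, m (Z ⊔ W) + m (Z ⊓ W) = m Z + m W) (a : Closeds X →₀ ℤ)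
    (ha : Finsupp.linearCombination ℤ (fun Z : Closeds X => (Z : Set X).indicator (1 : X → ℤ)) a
      = 0) :
    Finsupp.linearCombination ℤ m a = 0 := by
  classical
  suffices h : ∀ T : Closeds X, ∑ Z ∈ a.support, a Z • m (Z ⊓ T) = 0 by
    simpa [Finsupp.linearCombination_apply, Finsupp.sum] using h ⊤
  intro T
  induction T using WellFoundedLT.induction with
  | ind T ih =>
  by_cases hT : SupIrred T
  · set J := a.support.filter (T ≤ ·)
    set K := a.support.filter (¬ T ≤ ·)
    set T' : Closeds X := K.sup (· ⊓ T)
    have hle : T' ≤ T := Finset.sup_le fun _ _ => inf_le_right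
    have hne : T' ≠ T := by
      intro h
      obtain ⟨Z, hZ, h'⟩ := hT.finset_sup_eq h
      exact (Finset.mem_filter.1 hZ).2 (inf_eq_right.1 h')
    obtain ⟨x, hxT, hxT'⟩ : ∃ x ∈ T, x ∉ T' := by
      by_contra! h
      exact hne (le_antisymm hle h)
    have hJ : ∑ Z ∈ J, a Z = 0 := by
      have h1 := congrFun ha x
      simp only [Finsupp.linearCombination_apply, Finsupp.sum, Finset.sum_apply, Pi.smul_apply,
        Pi.zero_apply] at h1
      rw [← h1, ← Finset.sum_filter_add_sum_filter_not a.support (T ≤ ·),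
        Finset.sum_eq_zero (s := Finset.filter (fun Z => ¬ T ≤ Z) a.support), add_zero]
      · refine Finset.sum_congr rfl fun Z hZ => ?_
        rw [Set.indicator_of_mem ((Finset.mem_filter.1 hZ).2 hxT)]
        simp
      · intro Z hZ
        rw [Set.indicator_of_notMem, smul_zero]
        intro hx
        exact hxT' (Finset.le_sup (f := (· ⊓ T)) hZ ⟨hx, hxT⟩)
    have key : ∀ S ≤ T, ∑ Z ∈ a.support, a Z • m (Z ⊓ S) = ∑ Z ∈ K, a Z • m (Z ⊓ S) := by
      intro S hS
      rw [← Finset.sum_filter_add_sum_filter_not _ (T ≤ ·)]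
      convert zero_add _
      rw [Finset.sum_congr rfl (g := fun Z => a Z • m S), ← Finset.sum_smul, hJ, zero_smul]
      intro Z hZ
      rw [inf_eq_right.2 (hS.trans (Finset.mem_filter.1 hZ).2)]
    rw [key T le_rfl, ← ih T' (lt_of_le_of_ne hle hne), key T' hle]
    refine Finset.sum_congr rfl fun Z hZ => ?_
    congr 2
    exact le_antisymm (le_inf inf_le_left (Finset.le_sup (f := (· ⊓ T)) hZ))
      (inf_le_inf_left _ hle)
  · rcases not_supIrred.1 hT with h | ⟨B, C, hBC, hB, hC⟩
    · rw [isMin_iff_eq_bot.1 h]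
      simp [hbot]
    · have h1 : ∀ Z : Closeds X, m (Z ⊓ T) = m (Z ⊓ B) + m (Z ⊓ C) - m (Z ⊓ (B ⊓ C)) := by
        intro Z
        rw [← hBC, inf_sup_left, ← hm, ← inf_inf_distrib_left, add_sub_cancel_right]
      simp_rw [h1, smul_sub, smul_add, Finset.sum_sub_distrib, Finset.sum_add_distrib, ih B hB,
        ih C hC, ih (B ⊓ C) (inf_le_left.trans_lt hB)]
      simp

/-- `C` is a disjoint union of finitely many locally closed sets. -/
def HasLocallyClosedPartition {X : Type*} [TopologicalSpace X] (C : Set X) : Prop :=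
  ∃ S : Set (Set X), S.Finite ∧ (∀ A ∈ S, IsLocallyClosed A) ∧ S.PairwiseDisjoint id ∧ ⋃₀ S = C

theorem IsLocallyClosed.hasLocallyClosedPartition {X : Type*} [TopologicalSpace X] {C : Set X}
    (hC : IsLocallyClosed C) : HasLocallyClosedPartition C :=
  ⟨{C}, Set.finite_singleton _, by simpa, by simp, by simp⟩

theorem HasLocallyClosedPartition.inter {X : Type*} [TopologicalSpace X] {C D : Set X}
    (hC : HasLocallyClosedPartition C) (hD : HasLocallyClosedPartition D) :
    HasLocallyClosedPartition (C ∩ D) := by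
  obtain ⟨S, hS, hS', hSd, rfl⟩ := hC
  obtain ⟨T, hT, hT', hTd, rfl⟩ := hD
  refine ⟨Set.image2 (· ∩ ·) S T, hS.image2 _ hT, ?_, ?_, ?_⟩
  · rintro _ ⟨A, hA, B, hB, rfl⟩
    exact (hS' A hA).inter (hT' B hB)
  · rintro _ ⟨A, hA, B, hB, rfl⟩ _ ⟨A', hA', B', hB', rfl⟩ hne
    by_cases h : A = A'
    · have h' : B ≠ B' := fun h' => hne (by rw [h, h'])
      exact (hTd hB hB' h').mono Set.inter_subset_right Set.inter_subset_right
    · exact (hSd hA hA' h).mono Set.inter_subset_left Set.inter_subset_left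
  · ext x
    simp only [Set.mem_sUnion, Set.mem_image2, Set.mem_inter_iff]
    constructor
    · rintro ⟨_, ⟨A, hA, B, hB, rfl⟩, h1, h2⟩
      exact ⟨⟨A, hA, h1⟩, ⟨B, hB, h2⟩⟩
    · rintro ⟨⟨A, hA, h1⟩, ⟨B, hB, h2⟩⟩
      exact ⟨_, ⟨A, hA, B, hB, rfl⟩, h1, h2⟩

theorem IsLocallyClosed.hasLocallyClosedPartition_compl {X : Type*} [TopologicalSpace X]
    {C : Set X} (hC : IsLocallyClosed C) : HasLocallyClosedPartition Cᶜ := by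
  obtain ⟨U, Z, hU, hZ, rfl⟩ := hC
  refine ⟨{Zᶜ, Z ∩ Uᶜ}, by simp, ?_, ?_, ?_⟩
  · rintro A (rfl | rfl)
    · exact hZ.isOpen_compl.isLocallyClosed
    · exact (hZ.inter hU.isClosed_compl).isLocallyClosed
  · have h : Disjoint Zᶜ (Z ∩ Uᶜ) := disjoint_compl_left.mono_right Set.inter_subset_left
    rintro A (rfl | rfl) B (rfl | rfl) hne
    exacts [absurd rfl hne, h, h.symm, absurd rfl hne]
  · ext x
    simp only [Set.sUnion_insert, Set.sUnion_singleton, Set.mem_union, Set.mem_compl_iff,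
      Set.mem_inter_iff]
    tauto

theorem HasLocallyClosedPartition.compl {X : Type*} [TopologicalSpace X] {C : Set X}
    (hC : HasLocallyClosedPartition C) : HasLocallyClosedPartition Cᶜ := by
  obtain ⟨S, hS, hS', -, rfl⟩ := hC
  induction S, hS using Set.Finite.induction_on with
  | empty => simpa using isClosed_univ.isLocallyClosed.hasLocallyClosedPartition
  | @insert A S _ _ ih =>
    rw [Set.sUnion_insert, Set.compl_union]
    exact (IsLocallyClosed.hasLocallyClosedPartition_compl (hS' A (Set.mem_insert _ _))).inter
      (ih fun B hB => hS' B (Set.mem_insert_of_mem _ hB))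

theorem hasLocallyClosedPartition_of_isConstructible {X : Type*} [TopologicalSpace X] {C : Set X}
    (hC : Topology.IsConstructible C) : HasLocallyClosedPartition C := by
  induction hC using Topology.IsConstructible.empty_union_induction with
  | open_retrocompact U hU _ => exact IsLocallyClosed.hasLocallyClosedPartition hU.isLocallyClosed
  | union s _ t _ hs ht =>
    rw [← compl_compl (s ∪ t), Set.compl_union]
    exact (hs.compl.inter ht.compl).compl
  | compl s _ hs => exact hs.compl

instance isReduced_subscheme_vanishingIdeal {X : Scheme.{0}} (Z : Closeds X) :
    AlgebraicGeometry.IsReduced (Scheme.IdealSheafData.vanishingIdeal Z).subscheme := by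
  apply +allowSynthFailures @AlgebraicGeometry.IsReduced.of_openCover
    (𝒰 := (Scheme.IdealSheafData.vanishingIdeal Z).subschemeCover.openCover)
  intro (U : X.affineOpens)
  have : _root_.IsReduced (Γ(X, U.1) ⧸ (Scheme.IdealSheafData.vanishingIdeal Z).ideal U) := by
    rw [← Ideal.isRadical_iff_quotient_reduced]
    exact PrimeSpectrum.isRadical_vanishingIdeal _
  exact inferInstanceAs (AlgebraicGeometry.IsReduced (Spec (.of _)))

theorem nonempty_iso_of_range_eq {X V W : Scheme.{0}} (f : V ⟶ X) (g : W ⟶ X) [IsImmersion f]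
    [IsImmersion g] [AlgebraicGeometry.IsReduced V] [AlgebraicGeometry.IsReduced W]
    (h : Set.range f = Set.range g) : ∃ e : V ≅ W, e.hom ≫ g = f := by
  have h1 : Set.range (pullback.fst f g) = Set.univ := by
    rw [Scheme.Pullback.range_fst, ← h]; ext; simp
  have h2 : Set.range (pullback.snd f g) = Set.univ := by
    rw [Scheme.Pullback.range_snd, h]; ext; simp
  have : IsClosedImmersion (pullback.fst f g) := .of_isPreimmersion _ (h1 ▸ isClosed_univ)
  have : IsClosedImmersion (pullback.snd f g) := .of_isPreimmersion _ (h2 ▸ isClosed_univ)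
  have : Surjective (pullback.fst f g) := ⟨Set.range_eq_univ.1 h1⟩
  have : Surjective (pullback.snd f g) := ⟨Set.range_eq_univ.1 h2⟩
  have := isIso_of_isClosedImmersion_of_surjective (pullback.fst f g)
  have := isIso_of_isClosedImmersion_of_surjective (pullback.snd f g)
  exact ⟨(asIso (pullback.fst f g)).symm ≪≫ asIso (pullback.snd f g), by
    simp [← pullback.condition]⟩

instance (X : Variety) : AlgebraicGeometry.IsReduced X.obj.left := X.property.1
instance (X : Variety) : LocallyOfFiniteType X.obj.hom := X.property.2.1
instance (X : Variety) : QuasiCompact X.obj.hom := X.property.2.2.1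
instance (X : Variety) : IsSeparated X.obj.hom := X.property.2.2.2

/-- A reduced scheme immersed into a variety, as a variety. -/
def Variety.ofImmersion (X : Variety) {S : Scheme.{0}} (f : S ⟶ X.obj.left)
    [IsImmersion f] [AlgebraicGeometry.IsReduced S] : Variety where
  obj := Over.mk (f ≫ X.obj.hom)
  property := by
    have : NoetherianSpace X.Pt := inferInstance
    have h : NoetherianSpace S := f.isEmbedding.isInducing.noetherianSpace
    have : CompactSpace S := inferInstance
    refine ⟨‹_›, ?_, ?_, ?_⟩
    · exact inferInstanceAs (LocallyOfFiniteType (f ≫ X.obj.hom))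
    · show QuasiCompact (f ≫ X.obj.hom)
      have : QuasiCompact f := inferInstance
      infer_instance
    · exact inferInstanceAs (IsSeparated (f ≫ X.obj.hom))

/-- The immersion of `Variety.ofImmersion` into the ambient variety. -/
def Variety.ofImmersionι (X : Variety) {S : Scheme.{0}} (f : S ⟶ X.obj.left)
    [IsImmersion f] [AlgebraicGeometry.IsReduced S] : X.ofImmersion f ⟶ X :=
  ObjectProperty.homMk (Over.homMk f rfl)

theorem varClass_eq_of_iso {V W : Variety} (e : V ≅ W) : varClass V = varClass W := by
  rw [varClass, varClass, freeClass, freeClass, congr_toSkeleton_of_iso e]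

theorem varClass_eq_of_schemeIso {V W : Variety} (e : V.obj.left ≅ W.obj.left)
    (h : e.hom ≫ W.obj.hom = V.obj.hom) : varClass V = varClass W :=
  varClass_eq_of_iso (IsVariety.isoMk (Over.isoMk e h))

theorem varClass_eq_of_range_eq {X V W : Variety} (f : V ⟶ X) (g : W ⟶ X)
    (hf : IsImmersion (Variety.schemeHom f)) (hg : IsImmersion (Variety.schemeHom g))
    (h : Set.range (Variety.schemeHom f) = Set.range (Variety.schemeHom g)) :
    varClass V = varClass W := by
  obtain ⟨e, he⟩ := nonempty_iso_of_range_eq _ _ h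
  refine varClass_eq_of_schemeIso e ?_
  have hf' : Variety.schemeHom f ≫ X.obj.hom = V.obj.hom := Over.w f.hom
  have hg' : Variety.schemeHom g ≫ X.obj.hom = W.obj.hom := Over.w g.hom
  rw [← hf', ← hg', ← he, Category.assoc]

theorem varClass_tensor (V W : Variety) : varClass (V ⊗ W) = varClass V * varClass W := by
  rw [varClass, varClass, varClass, freeClass, freeClass, freeClass, ← map_mul,
    FreeAbelianGroup.of_mul_of, Skeleton.toSkeleton_tensorObj]

theorem varClass_point : varClass Variety.point = 1 := rfl

theorem varClass_scissor {V V' U : Variety} (i : V' ⟶ V) (j : U ⟶ V)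
    (hi : IsClosedImmersion (Variety.schemeHom i)) (hj : IsOpenImmersion (Variety.schemeHom j))
    (h : Set.range (Variety.schemeHom j) = (Set.range (Variety.schemeHom i))ᶜ) :
    varClass V = varClass V' + varClass U := by
  have : (Ideal.Quotient.mk (Ideal.span scissorRelations))
      (freeClass V - freeClass V' - freeClass U) = 0 :=
    Ideal.Quotient.eq_zero_iff_mem.2 (Ideal.subset_span ⟨V, V', U, i, j, hi, hj, h, rfl⟩)
  rw [map_sub, map_sub, sub_sub, sub_eq_zero] at this
  exact this

/-- A closed subset of a variety, with its reduced structure. -/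
def Variety.closedSub (X : Variety) (Z : Closeds X.Pt) : Variety :=
  X.ofImmersion (Scheme.IdealSheafData.vanishingIdeal Z).subschemeι

/-- The closed immersion of `Variety.closedSub` into the ambient variety. -/
def Variety.closedSubι (X : Variety) (Z : Closeds X.Pt) : X.closedSub Z ⟶ X :=
  X.ofImmersionι _

instance (X : Variety) (Z : Closeds X.Pt) :
    IsClosedImmersion (Variety.schemeHom (X.closedSubι Z)) :=
  inferInstanceAs (IsClosedImmersion (Scheme.IdealSheafData.vanishingIdeal Z).subschemeι)

theorem Variety.range_closedSubι (X : Variety) (Z : Closeds X.Pt) :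
    Set.range (Variety.schemeHom (X.closedSubι Z)) = Z :=
  (Scheme.IdealSheafData.range_subschemeι _).trans
    (Scheme.IdealSheafData.coe_support_vanishingIdeal _)

/-- The class of a closed subset of a variety. -/
def closedClass (X : Variety) (Z : Closeds X.Pt) : K0Var := varClass (X.closedSub Z)

theorem varClass_eq_closedClass {X V : Variety} (i : V ⟶ X) (Z : Closeds X.Pt)
    (hi : IsImmersion (Variety.schemeHom i)) (h : Set.range (Variety.schemeHom i) = Z) :
    varClass V = closedClass X Z :=
  varClass_eq_of_range_eq i (X.closedSubι Z) hi inferInstance (h.trans (X.range_closedSubι Z).symm)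

theorem varClass_eq_closedClass_top (X : Variety) : varClass X = closedClass X ⊤ :=
  varClass_eq_closedClass (𝟙 X) ⊤ (inferInstanceAs (IsImmersion (𝟙 X.obj.left))) (by
    show Set.range (𝟙 X.obj.left : X.obj.left ⟶ X.obj.left) = _
    simp)

/-- An open subset of a variety. -/
def Variety.openSub (X : Variety) (U : X.obj.left.Opens) : Variety := X.ofImmersion U.ι

/-- The open immersion of `Variety.openSub` into the ambient variety. -/
def Variety.openSubι (X : Variety) (U : X.obj.left.Opens) : X.openSub U ⟶ X := X.ofImmersionι _

instance (X : Variety) (U : X.obj.left.Opens) :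
    IsOpenImmersion (Variety.schemeHom (X.openSubι U)) :=
  inferInstanceAs (IsOpenImmersion U.ι)

theorem Variety.range_openSubι (X : Variety) (U : X.obj.left.Opens) :
    Set.range (Variety.schemeHom (X.openSubι U)) = U := U.range_ι

theorem Variety.range_schemeHom_comp {X Y Z : Variety} (f : X ⟶ Y) (g : Y ⟶ Z) :
    Set.range (Variety.schemeHom (f ≫ g)) =
      Variety.schemeHom g '' Set.range (Variety.schemeHom f) := by
  rw [← Set.range_comp]; rfl

/-- The open complement, inside `Z`, of a closed set `W`. -/
def Variety.diffOpens (X : Variety) (Z W : Closeds X.Pt) : (X.closedSub Z).obj.left.Opens :=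
  (Variety.schemeHom (X.closedSubι Z)) ⁻¹ᵁ W.compl

/-- The locally closed subvariety `Z \ W`. -/
def Variety.diffSub (X : Variety) (Z W : Closeds X.Pt) : Variety :=
  (X.closedSub Z).openSub (X.diffOpens Z W)

/-- The immersion of `Z \ W` into the ambient variety. -/
def Variety.diffSubι (X : Variety) (Z W : Closeds X.Pt) : X.diffSub Z W ⟶ X :=
  (X.closedSub Z).openSubι _ ≫ X.closedSubι Z

instance (X : Variety) (Z W : Closeds X.Pt) :
    IsImmersion (Variety.schemeHom (X.diffSubι Z W)) :=
  inferInstanceAs (IsImmersion (Variety.schemeHom ((X.closedSub Z).openSubι _) ≫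
    Variety.schemeHom (X.closedSubι Z)))

theorem Variety.range_diffSubι (X : Variety) (Z W : Closeds X.Pt) :
    Set.range (Variety.schemeHom (X.diffSubι Z W)) = (Z : Set X.Pt) \ W := by
  refine (Variety.range_schemeHom_comp ((X.closedSub Z).openSubι _) (X.closedSubι Z)).trans ?_
  rw [Variety.range_openSubι]
  show _ '' (_ ⁻¹' (W : Set X.Pt)ᶜ) = _
  rw [Set.image_preimage_eq_inter_range, Variety.range_closedSubι, Set.inter_comm]
  rfl

theorem closedClass_eq_add {X V : Variety} (i : V ⟶ X) (Z W : Closeds X.Pt)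
    (hi : IsImmersion (Variety.schemeHom i)) (hWZ : W ≤ Z)
    (h : Set.range (Variety.schemeHom i) = (Z : Set X.Pt) \ W) :
    closedClass X Z = closedClass X W + varClass V := by
  rw [varClass_eq_of_range_eq i (X.diffSubι Z W) hi inferInstance
    (h.trans (X.range_diffSubι Z W).symm)]
  let f := X.closedSubι Z
  let W' : Closeds (X.closedSub Z).Pt := W.preimage (Variety.schemeHom f).continuous
  have h1 := varClass_scissor ((X.closedSub Z).closedSubι W')
    ((X.closedSub Z).openSubι (X.diffOpens Z W)) inferInstance inferInstance (by
      rw [Variety.range_closedSubι, Variety.range_openSubι]; rfl)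
  refine h1.trans (congrArg (· + _) ?_)
  refine varClass_eq_closedClass ((X.closedSub Z).closedSubι W' ≫ f) W ?_ ?_
  · exact inferInstanceAs (IsImmersion (Variety.schemeHom ((X.closedSub Z).closedSubι W') ≫
      Variety.schemeHom (X.closedSubι Z)))
  · rw [Variety.range_schemeHom_comp, Variety.range_closedSubι]
    show _ '' (_ ⁻¹' (W : Set X.Pt)) = _
    rw [Set.image_preimage_eq_inter_range, Variety.range_closedSubι]
    exact Set.inter_eq_left.2 hWZ

theorem closedClass_bot (X : Variety) : closedClass X ⊥ = 0 := by
  have := closedClass_eq_add (X.diffSubι ⊥ ⊥) ⊥ ⊥ inferInstance le_rfl (X.range_diffSubι ⊥ ⊥)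
  rw [varClass_eq_closedClass (X.diffSubι ⊥ ⊥) ⊥ inferInstance
    ((X.range_diffSubι ⊥ ⊥).trans (by simp))] at this
  simpa using this

theorem closedClass_sup_add_inf (X : Variety) (Z W : Closeds X.Pt) :
    closedClass X (Z ⊔ W) + closedClass X (Z ⊓ W) = closedClass X Z + closedClass X W := by
  rw [closedClass_eq_add (X.diffSubι Z W) (Z ⊔ W) W inferInstance le_sup_right
      ((X.range_diffSubι Z W).trans (by simp)),
    closedClass_eq_add (X.diffSubι Z W) Z (Z ⊓ W) inferInstance inf_le_left
      ((X.range_diffSubι Z W).trans (by simp))]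
  abel

/-- The function `∑ n_Z 1_Z` of a formal combination of closed sets. -/
abbrev closedEval (X : Variety) : (Closeds X.Pt →₀ ℤ) →ₗ[ℤ] X.Pt → ℤ :=
  Finsupp.linearCombination ℤ fun Z : Closeds X.Pt => (Z : Set X.Pt).indicator 1

/-- The class `∑ n_Z [Z]` of a formal combination of closed sets. -/
abbrev closedTotal (X : Variety) : (Closeds X.Pt →₀ ℤ) →ₗ[ℤ] K0Var :=
  Finsupp.linearCombination ℤ (closedClass X)

theorem closedTotal_eq_of_closedEval_eq (X : Variety) {a b : Closeds X.Pt →₀ ℤ}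
    (h : closedEval X a = closedEval X b) : closedTotal X a = closedTotal X b := by
  rw [← sub_eq_zero, ← map_sub] at h ⊢
  exact linearCombination_valuation_eq_zero _ (closedClass_bot X) (closedClass_sup_add_inf X) _ h

theorem _root_.Finsupp.linearCombination_single_sub_single {ι A : Type*} [AddCommGroup A]
    (m : ι → A) (i j : ι) :
    Finsupp.linearCombination ℤ m (.single i 1 - .single j 1) = m i - m j := by
  simp

theorem _root_.Set.indicator_one_sub_of_subset {X : Type*} {Z W : Set X} (h : W ⊆ Z) :
    Z.indicator (1 : X → ℤ) - W.indicator 1 = (Z \ W).indicator 1 := by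
  ext x
  by_cases hx : x ∈ W
  · simp [hx, h hx]
  · by_cases hz : x ∈ Z <;> simp [hx, hz]

theorem _root_.IsLocallyClosed.exists_closeds_diff {X : Type*} [TopologicalSpace X] {A : Set X}
    (hA : IsLocallyClosed A) : ∃ Z W : Closeds X, W ≤ Z ∧ A = (Z : Set X) \ W := by
  obtain ⟨U, K, hU, hK, rfl⟩ := hA
  refine ⟨⟨K, hK⟩, ⟨K ∩ Uᶜ, hK.inter hU.isClosed_compl⟩, Set.inter_subset_left, ?_⟩
  ext x
  simp only [Closeds.coe_mk, Set.mem_inter_iff, Set.mem_sdiff, Set.mem_compl_iff]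
  tauto

theorem exists_closedEval_eq_indicator_range {X V : Variety} (i : V ⟶ X)
    (hi : IsImmersion (Variety.schemeHom i)) :
    ∃ a, closedEval X a = (Set.range (Variety.schemeHom i)).indicator 1 ∧
      closedTotal X a = varClass V := by
  obtain ⟨Z, W, hWZ, h⟩ := (Variety.schemeHom i).isLocallyClosed_range.exists_closeds_diff
  refine ⟨.single Z 1 - .single W 1, ?_, ?_⟩
  · rw [closedEval, Finsupp.linearCombination_single_sub_single, h]
    exact Set.indicator_one_sub_of_subset hWZ
  · rw [closedTotal, Finsupp.linearCombination_single_sub_single, closedClass_eq_add i Z W hi hWZ h,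
      add_sub_cancel_left]

theorem IsPartitionClass.exists_closedEval {X : Variety} {C : Set X.Pt} {c : K0Var}
    (h : IsPartitionClass C c) :
    ∃ a, closedEval X a = C.indicator 1 ∧ closedTotal X a = c := by
  obtain ⟨k, V, i, hi, hd, rfl, rfl⟩ := h
  choose a ha ha' using fun j => exists_closedEval_eq_indicator_range (i j) (hi j)
  refine ⟨∑ j, a j, ?_, by simp_rw [map_sum, ha']⟩
  simp_rw [map_sum, ha]
  ext x
  rw [Finset.sum_apply]
  by_cases hx : x ∈ ⋃ j, Set.range (Variety.schemeHom (i j))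
  · obtain ⟨j, hj⟩ := Set.mem_iUnion.1 hx
    rw [Set.indicator_of_mem hx, Finset.sum_eq_single j, Set.indicator_of_mem hj]
    · exact fun l _ hl => Set.indicator_of_notMem (Set.disjoint_left.1 (hd hl.symm) hj) _
    · simp
  · rw [Set.indicator_of_notMem hx]
    exact Finset.sum_eq_zero fun j _ =>
      Set.indicator_of_notMem (fun hj => hx (Set.mem_iUnion.2 ⟨j, hj⟩)) _

theorem exists_isPartitionClass {X : Variety} {C : Set X.Pt} (hC : Topology.IsConstructible C) :
    ∃ c, IsPartitionClass C c := by
  obtain ⟨S, hS, hS', hSd, rfl⟩ := hasLocallyClosedPartition_of_isConstructible hC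
  have := hS.fintype
  choose Z W hWZ h using fun A : S => (hS' A A.2).exists_closeds_diff
  let e := (Fintype.equivFin S).symm
  have hr : ∀ j, Set.range (Variety.schemeHom (X.diffSubι (Z (e j)) (W (e j)))) = (e j : Set X.Pt) :=
    fun j => (X.range_diffSubι _ _).trans (h (e j)).symm
  refine ⟨_, _, fun j => X.diffSub (Z (e j)) (W (e j)), fun j => X.diffSubι (Z (e j)) (W (e j)),
    fun j => inferInstance, ?_, ?_, rfl⟩
  · intro j l hjl
    rw [hr, hr]
    exact hSd (e j).2 (e l).2 fun h => hjl (e.injective (Subtype.ext h))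
  · simp_rw [hr]
    rw [Set.sUnion_eq_iUnion]
    exact e.surjective.iUnion_comp (fun A : S => (A : Set X.Pt))

theorem exists_closedEval_eq_constrFun {X : Variety} (α : ConstrFun X) :
    ∃ a, closedEval X a = α.1 ∧ closedTotal X a = grothendieckClass α := by
  have h : ∀ n : ℤ, ∃ a, closedEval X a = (α.1 ⁻¹' {n}).indicator 1 ∧
      closedTotal X a = constrClass (α.1 ⁻¹' {n}) := by
    intro n
    have h := exists_isPartitionClass (α.2.2 n)
    rw [constrClass, dif_pos h]
    exact h.choose_spec.exists_closedEval
  choose a ha ha' using h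
  refine ⟨∑ n ∈ α.2.1.toFinset, n • a n, ?_, by simp_rw [map_sum, map_smul, ha']; rfl⟩
  simp_rw [map_sum, map_smul, ha]
  ext x
  simp only [Finset.sum_apply, Pi.smul_apply, smul_eq_mul]
  rw [Finset.sum_eq_single (α.1 x)]
  · simp
  · intro n _ hn
    rw [Set.indicator_of_notMem (by simpa using hn.symm), mul_zero]
  · simp

theorem grothendieckClass_eq {X : Variety} (α : ConstrFun X) (a : Closeds X.Pt →₀ ℤ)
    (h : closedEval X a = α.1) : grothendieckClass α = closedTotal X a := by
  obtain ⟨b, hb, hb'⟩ := exists_closedEval_eq_constrFun α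
  rw [← hb', closedTotal_eq_of_closedEval_eq X (hb.trans h.symm)]

theorem grothendieckClass_add {X : Variety} (α β : ConstrFun X) :
    grothendieckClass (α + β) = grothendieckClass α + grothendieckClass β := by
  obtain ⟨a, ha, ha'⟩ := exists_closedEval_eq_constrFun α
  obtain ⟨b, hb, hb'⟩ := exists_closedEval_eq_constrFun β
  rw [← ha', ← hb', ← map_add]
  exact grothendieckClass_eq _ _ (by rw [map_add, ha, hb]; rfl)

/-- The homomorphism `Γ : F(X) → K₀(𝒱_ℂ)`. -/
def grothendieckHom (X : Variety) : ConstrFun X →+ K0Var :=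
  AddMonoidHom.mk' grothendieckClass grothendieckClass_add

/-- The preimage of a closed subset under a morphism of varieties. -/
abbrev Variety.closedPreimage {X Y : Variety} (π : X ⟶ Y) (Z : Closeds Y.Pt) : Closeds X.Pt :=
  Z.preimage (Variety.schemeHom π).continuous

theorem isClassMultiplicative_iff {X Y : Variety} (π : X ⟶ Y) (F : Variety) :
    IsClassMultiplicative π F ↔ ∀ Z : Closeds Y.Pt,
      closedClass X (Variety.closedPreimage π Z) = closedClass Y Z * varClass F := by
  constructor
  · intro h Z
    refine h _ _ (Y.closedSubι Z) (X.closedSubι _) inferInstance inferInstance ?_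
    rw [Variety.range_closedSubι, Variety.range_closedSubι]
    rfl
  · intro h Z P i j hi hj hij
    let Z' : Closeds Y.Pt := ⟨_, (Variety.schemeHom i).isClosedEmbedding.isClosed_range⟩
    rw [varClass_eq_closedClass i Z' inferInstance rfl, ← h,
      varClass_eq_closedClass j (Variety.closedPreimage π Z') inferInstance hij]

theorem IsClassMultiplicative.grothendieckClass_pullback {X Y : Variety} {π : X ⟶ Y} {F : Variety}
    (h : IsClassMultiplicative π F) (α : ConstrFun Y) :
    grothendieckClass (ConstrFun.pullback π α) = grothendieckClass α * varClass F := by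
  rw [isClassMultiplicative_iff] at h
  obtain ⟨a, ha, ha'⟩ := exists_closedEval_eq_constrFun α
  rw [grothendieckClass_eq (ConstrFun.pullback π α)
    (Finsupp.mapDomain (Variety.closedPreimage π) a), ← ha']
  · rw [closedTotal, Finsupp.linearCombination_mapDomain, closedTotal,
      Finsupp.linearCombination_apply, Finsupp.linearCombination_apply, Finsupp.sum, Finsupp.sum,
      Finset.sum_mul]
    exact Finset.sum_congr rfl fun Z _ => by
      rw [Function.comp_apply, h]
      exact (smul_mul_assoc (a Z) (closedClass Y Z) (varClass F)).symm
  · show _ = α.1 ∘ Variety.schemeHom π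
    rw [← ha, closedEval, Finsupp.linearCombination_mapDomain]
    ext x
    simp [closedEval, Finsupp.linearCombination_apply, Finsupp.sum, Set.indicator]
    rfl

theorem exists_iso_pullback_of_comp_eq {A B D U : Scheme.{0}} (f : U ⟶ D) (g : B ⟶ D) (t : A ⟶ U)
    (d : A ⟶ D) (h : t ≫ f = d) :
    ∃ c : Limits.pullback t (Limits.pullback.fst f g) ≅ Limits.pullback d g,
      c.hom ≫ Limits.pullback.fst _ _ = Limits.pullback.fst _ _ := by
  subst h
  exact ⟨pullbackRightPullbackFstIso f g t, by simp⟩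

/-- Over a trivialising open set `U`, the preimage of a subvariety `T` of `U` is an immersed copy
of `T × F`. -/
theorem exists_immersion_of_trivialization {X Y F T : Variety} (π : X ⟶ Y) (U : Y.obj.left.Opens)
    (e : ((Variety.schemeHom π) ⁻¹ᵁ U).toScheme ≅ Limits.pullback (U.ι ≫ Y.obj.hom) F.obj.hom)
    (he : e.hom ≫ Limits.pullback.fst _ _ = Variety.schemeHom π ∣_ U) (i : T ⟶ Y)
    (hi : IsImmersion (Variety.schemeHom i)) (hU : Set.range (Variety.schemeHom i) ⊆ U) :
    ∃ (Q : Variety) (g : Q ⟶ X), IsImmersion (Variety.schemeHom g) ∧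
      Set.range (Variety.schemeHom g) = Variety.schemeHom π ⁻¹' Set.range (Variety.schemeHom i) ∧
      varClass Q = varClass T * varClass F := by
  let t : T.obj.left ⟶ U.toScheme :=
    IsOpenImmersion.lift U.ι (Variety.schemeHom i) (by simpa using hU)
  have ht : t ≫ U.ι = Variety.schemeHom i := IsOpenImmersion.lift_fac _ _ _
  have : IsImmersion (t ≫ U.ι) := ht ▸ hi
  have : IsImmersion t := IsImmersion.of_comp t U.ι
  have hT : t ≫ U.ι ≫ Y.obj.hom = T.obj.hom := by
    rw [← Category.assoc, ht]; exact Over.w i.hom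
  have hX : Variety.schemeHom π ≫ Y.obj.hom = X.obj.hom := Over.w π.hom
  let p := Limits.pullback.fst (U.ι ≫ Y.obj.hom) F.obj.hom
  have hp : p = e.inv ≫ Variety.schemeHom π ∣_ U := by rw [← he, e.inv_hom_id_assoc]
  let S := Limits.pullback t p
  obtain ⟨c, hc⟩ : ∃ c : S ≅ Limits.pullback T.obj.hom F.obj.hom,
      c.hom ≫ pullback.fst _ _ = pullback.fst t p :=
    exists_iso_pullback_of_comp_eq (U.ι ≫ Y.obj.hom) F.obj.hom t T.obj.hom hT
  have : AlgebraicGeometry.IsReduced (Limits.pullback T.obj.hom F.obj.hom) :=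
    isReduced_pullback_of_isAlgClosed _ _
  have : AlgebraicGeometry.IsReduced S := isReduced_of_isOpenImmersion c.hom
  let g : S ⟶ X.obj.left := pullback.snd t p ≫ e.inv ≫ ((Variety.schemeHom π) ⁻¹ᵁ U).ι
  have hg : g ≫ Variety.schemeHom π = pullback.fst t p ≫ Variety.schemeHom i := by
    simp only [g, Category.assoc]
    rw [← morphismRestrict_ι, ← Category.assoc e.inv, ← hp, ← Category.assoc, ← pullback.condition,
      Category.assoc, ht]
  refine ⟨X.ofImmersion g, X.ofImmersionι g, inferInstanceAs (IsImmersion g), ?_, ?_⟩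
  · show Set.range g = _
    ext x
    constructor
    · rintro ⟨s, rfl⟩
      refine ⟨pullback.fst t p s, ?_⟩
      rw [← Scheme.Hom.comp_apply, ← hg, Scheme.Hom.comp_apply]
    · rintro ⟨τ, hτ⟩
      have hx : Variety.schemeHom π x ∈ U := hU ⟨τ, hτ⟩
      obtain ⟨x', rfl⟩ : ∃ x', ((Variety.schemeHom π) ⁻¹ᵁ U).ι x' = x := ⟨⟨x, hx⟩, rfl⟩
      have h1 : t τ = p (e.hom x') := by
        apply U.ι.isOpenEmbedding.injective
        rw [← Scheme.Hom.comp_apply, ht, hτ, ← Scheme.Hom.comp_apply, ← Scheme.Hom.comp_apply,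
          ← Scheme.Hom.comp_apply, ← morphismRestrict_ι, ← he]
        rfl
      have h2 : e.hom x' ∈ Set.range (pullback.snd t p) := by
        rw [Scheme.Pullback.range_snd]
        exact ⟨τ, h1⟩
      obtain ⟨s, hs⟩ := h2
      refine ⟨s, ?_⟩
      simp only [g, Scheme.Hom.comp_apply, hs]
      rw [← Scheme.Hom.comp_apply e.hom, e.hom_inv_id]
      rfl
  · rw [← varClass_tensor]
    refine varClass_eq_of_schemeIso (V := X.ofImmersion g) (W := T ⊗ F) c ?_
    show c.hom ≫ pullback.fst _ _ ≫ T.obj.hom = g ≫ X.obj.hom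
    rw [← hX, ← Category.assoc, hc, ← Category.assoc, hg, Category.assoc]
    exact congrArg _ (Over.w i.hom).symm

theorem IsZariskiBundle.isClassMultiplicative {X Y F : Variety} {π : X ⟶ Y}
    (h : IsZariskiBundle π F) : IsClassMultiplicative π F := by
  rw [isClassMultiplicative_iff]
  intro Z
  induction Z using WellFoundedLT.induction with
  | ind Z ih =>
  rcases (Z : Set Y.Pt).eq_empty_or_nonempty with hZ | ⟨y, hy⟩
  · obtain rfl : Z = ⊥ := SetLike.coe_injective hZ
    rw [closedClass_bot, zero_mul]
    exact closedClass_bot X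
  · obtain ⟨U, hyU, e, he⟩ := h y
    let W : Closeds Y.Pt := Z ⊓ U.compl
    have hWZ : W ≤ Z := inf_le_left
    have hlt : W < Z := lt_of_le_of_ne hWZ fun h => by
      have hyW : y ∈ W := h ▸ hy
      exact hyW.2 hyU
    have hr : Set.range (Variety.schemeHom (Y.diffSubι Z W)) ⊆ U := by
      rw [Variety.range_diffSubι]
      rintro x ⟨hx, hx'⟩
      by_contra hxU
      exact hx' ⟨hx, hxU⟩
    obtain ⟨Q, g, hg, hgr, hQ⟩ :=
      exists_immersion_of_trivialization π U e he (Y.diffSubι Z W) inferInstance hr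
    rw [closedClass_eq_add g (Variety.closedPreimage π Z) (Variety.closedPreimage π W) hg
      (fun x hx => hWZ hx) (by rw [hgr, Variety.range_diffSubι]; rfl), ih W hlt, hQ,
      closedClass_eq_add (Y.diffSubι Z W) Z W inferInstance hWZ (Y.range_diffSubι Z W), add_mul]

theorem IsClassMultiplicative.varClass_eq {X Y F : Variety} {π : X ⟶ Y}
    (h : IsClassMultiplicative π F) : varClass X = varClass Y * varClass F := by
  rw [varClass_eq_closedClass_top X, varClass_eq_closedClass_top Y]
  exact (isClassMultiplicative_iff π F).1 h ⊤

theorem ConstrFun.pullback_comp {X Y Z : Variety} (f : X ⟶ Y) (g : Y ⟶ Z) (α : ConstrFun Z) :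
    ConstrFun.pullback (f ≫ g) α = ConstrFun.pullback f (ConstrFun.pullback g α) := rfl

theorem ConstrFun.pullback_id {X : Variety} (α : ConstrFun X) :
    ConstrFun.pullback (𝟙 X) α = α := rfl

theorem Tower.grothendieckClass_pullback_str (X : Tower) (F : ℕ → Variety)
    (h : ∀ n : ℕ+, IsClassMultiplicative (X.step n) (F n)) {n m : ℕ+} (hnm : n ≤ m)
    (α : ConstrFun (X.term n)) :
    grothendieckClass (ConstrFun.pullback (X.str hnm) α) =
      (∏ j ∈ Finset.Ico (n : ℕ) m, varClass (F j)) * grothendieckClass α := by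
  induction m using PNat.recOn with
  | one =>
    obtain rfl : n = 1 := le_antisymm hnm one_le
    have : X.str hnm = 𝟙 _ := X.map_id _
    rw [this, ConstrFun.pullback_id]
    simp
  | succ m ih =>
    rcases hnm.eq_or_lt with rfl | hlt
    · have : X.str hnm = 𝟙 _ := X.map_id _
      rw [this, ConstrFun.pullback_id]
      simp
    · have hle : n ≤ m := PNat.lt_add_one_iff.1 hlt
      have : X.str hnm = X.step m ≫ X.str hle := by
        rw [← X.map_comp]; rfl
      rw [this, ConstrFun.pullback_comp, (h m).grothendieckClass_pullback, ih hle, PNat.add_coe,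
        PNat.one_coe, Finset.prod_Ico_succ_top (by exact_mod_cast hle)]
      ring

/-- The homomorphism `F^pro(X_∞) → colim K₀(𝒱_ℂ)` which is `Γ` at every level. -/
def proToColim (X : Tower) (F : ℕ → Variety)
    (h : ∀ n : ℕ+, IsClassMultiplicative (X.step n) (F n)) : ProConstr X →+ K0Colim F :=
  AddCommGroup.DirectLimit.lift _ _ _ (fun n => (K0Colim.of F n).comp (grothendieckHom (X.term n)))
    fun n m hnm α => by
      show K0Colim.of F m (grothendieckClass _) = K0Colim.of F n (grothendieckClass α)
      rw [X.grothendieckClass_pullback_str F h hnm]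
      exact AddCommGroup.DirectLimit.of_f (G := fun _ : ℕ+ => K0Var) (f := fun n m _ =>
        AddMonoidHom.mulLeft (∏ j ∈ Finset.Ico (n : ℕ) m, varClass (F j))) hnm _

theorem proToColim_proClass (X : Tower) (F : ℕ → Variety)
    (h : ∀ n : ℕ+, IsClassMultiplicative (X.step n) (F n)) (n : ℕ+) (α : ConstrFun (X.term n)) :
    proToColim X F h (proClass X n α) = K0Colim.of F n (grothendieckClass α) :=
  AddCommGroup.DirectLimit.lift_of ..

/-- Division by `[F₀] ⋯ [F_{n-1}]`. -/
def divDenom (F : ℕ → Variety) (n : ℕ) : K0Var →+ K0Loc F :=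
  AddMonoidHom.mk' (fun c => Localization.mk c (fibreDenom F n)) fun a b => by
    rw [Localization.add_mk_self]

theorem mk_fibreDenom_of_le (F : ℕ → Variety) {n m : ℕ} (h : n ≤ m) (c : K0Var) :
    Localization.mk ((∏ j ∈ Finset.Ico n m, varClass (F j)) * c) (fibreDenom F m) =
      Localization.mk c (fibreDenom F n) := by
  rw [Localization.mk_eq_mk_iff, Localization.r_iff_exists]
  refine ⟨1, ?_⟩
  have : (fibreDenom F m : K0Var) =
      fibreDenom F n * ∏ j ∈ Finset.Ico n m, varClass (F j) :=
    (Finset.prod_range_mul_prod_Ico _ h).symm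
  rw [this]
  ring

/-- The homomorphism `colim K₀(𝒱_ℂ) → K₀(𝒱_ℂ)_𝓕` dividing the `n`-th copy by
`[F₀] ⋯ [F_{n-1}]`. -/
def colimToLoc (F : ℕ → Variety) : K0Colim F →+ K0Loc F :=
  AddCommGroup.DirectLimit.lift _ _ _ (fun n => divDenom F n) fun _ _ hnm c =>
    mk_fibreDenom_of_le F hnm c

theorem colimToLoc_of (F : ℕ → Variety) (n : ℕ+) (c : K0Var) :
    colimToLoc F (K0Colim.of F n c) = Localization.mk c (fibreDenom F n) :=
  AddCommGroup.DirectLimit.lift_of ..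

theorem proConstr_hom_ext {X : Tower} {A : Type*} [AddCommGroup A] {G G' : ProConstr X →+ A}
    (h : ∀ n α, G (proClass X n α) = G' (proClass X n α)) : G = G' :=
  AddCommGroup.DirectLimit.hom_ext (G := fun n : ℕ+ => ConstrFun (X.term n))
    (f := fun _ _ h => ConstrFun.pullback (X.str h)) A fun n => AddMonoidHom.ext (h n)

theorem IsCanonicalProclass.apply_proClass {X : Tower} {F : ℕ → Variety}
    {G : ProConstr X →+ K0Loc F} (h : IsCanonicalProclass X F G) (n : ℕ+)
    (α : ConstrFun (X.term n)) :
    G (proClass X n α) = Localization.mk (grothendieckClass α) (fibreDenom F n) := by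
  obtain ⟨γ, φ, hγ, hφ, rfl⟩ := h
  rw [AddMonoidHom.comp_apply, hγ, hφ]

theorem exists_isCanonicalProclass (X : Tower) (F : ℕ → Variety)
    (h : ∀ n : ℕ+, IsClassMultiplicative (X.step n) (F n)) :
    ∃ G : ProConstr X →+ K0Loc F,
      IsCanonicalProclass X F G ∧ (∀ G', IsCanonicalProclass X F G' → G' = G) ∧
      ∀ (s : Finset ℕ+) (α : ∀ n : ℕ+, ConstrFun (X.term n)),
        G (∑ n ∈ s, proClass X n (α n)) =
          ∑ n ∈ s, Localization.mk (grothendieckClass (α n)) (fibreDenom F n) := by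
  have hG : IsCanonicalProclass X F ((colimToLoc F).comp (proToColim X F h)) :=
    ⟨_, _, proToColim_proClass X F h, colimToLoc_of F, rfl⟩
  refine ⟨_, hG, fun G' hG' => proConstr_hom_ext fun n α => ?_, fun s α => ?_⟩
  · rw [hG.apply_proClass, hG'.apply_proClass]
  · rw [map_sum]
    exact Finset.sum_congr rfl fun n _ => hG.apply_proClass n (α n)

theorem fibreMonoid_constFibre (W : Variety) :
    fibreMonoid (constFibre W) = Submonoid.powers (varClass W) := by
  apply le_antisymm
  · refine Submonoid.closure_le.2 ?_
    rintro _ ⟨_ | j, rfl⟩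
    · exact one_mem (Submonoid.powers (varClass W))
    · exact Submonoid.mem_powers (varClass W)
  · exact Submonoid.powers_le.2 (varClass_mem_fibreMonoid (constFibre W) 1)

theorem fibreDenom_constFibre (W : Variety) (n : ℕ+) :
    fibreDenom (constFibre W) n = constDenom W (n - 1) := by
  obtain ⟨k, hk⟩ := Nat.exists_eq_succ_of_ne_zero n.ne_zero
  apply Subtype.ext
  rw [hk]
  show ∏ j ∈ Finset.range (k + 1), varClass (constFibre W j) = varClass W ^ k
  rw [Finset.prod_range_succ']
  show (∏ _j ∈ Finset.range k, varClass W) * varClass Variety.point = _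
  rw [varClass_point, mul_one, Finset.prod_const, Finset.card_range]

theorem val_constUnit (W : Variety) :
    (constUnit W : K0Loc (constFibre W)) = algebraMap K0Var _ (varClass W) :=
  IsUnit.unit_spec _

theorem mk_constDenom (W : Variety) (c : K0Var) (k : ℕ) :
    (Localization.mk c (constDenom W k) : K0Loc (constFibre W)) =
      algebraMap K0Var (K0Loc (constFibre W)) c *
        ((constUnit W ^ (-(k : ℤ)) : (K0Loc (constFibre W))ˣ) : K0Loc (constFibre W)) := by
  rw [zpow_neg, zpow_natCast, Units.eq_mul_inv_iff_mul_eq, Units.val_pow_eq_pow_val, val_constUnit,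
    ← map_pow, Localization.mk_eq_mk'_apply]
  exact IsLocalization.mk'_spec _ c (constDenom W k)

theorem isClassMultiplicative_constFibre {X : Tower} {W : Variety}
    (h : ∀ n : ℕ+, IsClassMultiplicative (X.step n) W) (n : ℕ+) :
    IsClassMultiplicative (X.step n) (constFibre W n) := by
  have : constFibre W n = W := by
    obtain ⟨k, hk⟩ := Nat.exists_eq_succ_of_ne_zero n.ne_zero
    rw [hk]
    rfl
  rw [this]
  exact h n

end

end ProMotivic

theorem mainTheorem10 :
    (∀ (X Y F : Variety) (π : X ⟶ Y), IsZariskiBundle π F →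
      varClass X = varClass Y * varClass F ∧ IsClassMultiplicative π F) ∧
    (∀ (X : Tower) (F : ℕ → Variety), Nonempty (F 0 ≅ Variety.point) →
      (∀ n : ℕ+, IsClassMultiplicative (X.step n) (F n)) →
      ∃ G : ProConstr X →+ K0Loc F,
        IsCanonicalProclass X F G ∧ (∀ G', IsCanonicalProclass X F G' → G' = G) ∧
        ∀ (s : Finset ℕ+) (α : ∀ n : ℕ+, ConstrFun (X.term n)),
          G (∑ n ∈ s, proClass X n (α n)) =
            ∑ n ∈ s, Localization.mk (grothendieckClass (α n)) (fibreDenom F n)) ∧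
    (∀ (X : Tower) (W : Variety), (∀ n : ℕ+, IsClassMultiplicative (X.step n) W) →
      fibreMonoid (constFibre W) = Submonoid.powers (varClass W) ∧
      (∃ G : ProConstr X →+ K0Loc (constFibre W),
        IsCanonicalProclass X (constFibre W) G ∧
        (∀ G', IsCanonicalProclass X (constFibre W) G' → G' = G) ∧
        ∀ (s : Finset ℕ+) (α : ∀ n : ℕ+, ConstrFun (X.term n)),
          G (∑ n ∈ s, proClass X n (α n)) =
            ∑ n ∈ s, Localization.mk (grothendieckClass (α n)) (constDenom W (n - 1))) ∧
      ∀ w : ℤ, ∃! G : ProConstr X →+ K0Loc (constFibre W),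
        ∀ (s : Finset ℕ+) (α : ∀ n : ℕ+, ConstrFun (X.term n)),
          G (∑ n ∈ s, proClass X n (α n)) =
            ∑ n ∈ s, algebraMap K0Var (K0Loc (constFibre W)) (grothendieckClass (α n)) *
              ((constUnit W ^ (-((n : ℤ) - 1 + w)) : (K0Loc (constFibre W))ˣ) :
                K0Loc (constFibre W))) := by
  refine ⟨fun X Y F π h => ⟨h.isClassMultiplicative.varClass_eq, h.isClassMultiplicative⟩,
    fun X F _ h => exists_isCanonicalProclass X F h, fun X W h => ?_⟩
  obtain ⟨G, hG, hu, hs⟩ :=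
    exists_isCanonicalProclass X (constFibre W) (isClassMultiplicative_constFibre h)
  simp_rw [fibreDenom_constFibre] at hs
  refine ⟨fibreMonoid_constFibre W, ⟨G, hG, hu, hs⟩, fun w => ?_⟩
  refine ⟨(AddMonoidHom.mulRight ((constUnit W ^ (-w) : (K0Loc (constFibre W))ˣ) :
    K0Loc (constFibre W))).comp G, fun s α => ?_, fun G' hG' => proConstr_hom_ext fun n α => ?_⟩
  · rw [AddMonoidHom.comp_apply, hs, AddMonoidHom.mulRight_apply, Finset.sum_mul]
    refine Finset.sum_congr rfl fun n _ => ?_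
    rw [mk_constDenom, mul_assoc, ← Units.val_mul, ← zpow_add, Nat.cast_pred n.pos, neg_add]
  · have h1 := hG' {n} (Function.update 0 n α)
    simp only [Finset.sum_singleton, Function.update_self] at h1
    rw [h1, AddMonoidHom.comp_apply, hG.apply_proClass, fibreDenom_constFibre,
      AddMonoidHom.mulRight_apply, mk_constDenom, mul_assoc, ← Units.val_mul, ← zpow_add,
      Nat.cast_pred n.pos, neg_add]
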